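/- Let $L$ be a link (in $S^3$) whose determinant $\det L$ is non-zero, and let $p \ge 17$ be a prime such that $L$ admits non-trivial $p$-colorings. Then $\operatorname{mincol}_p L \ge 6$. Here a Fox $p$-coloring of a link diagram $D$ assigns to each arc of $D$ an element of $\mathbb{Z}/p\mathbb{Z}$ such that, at each crossing, twice the value on the over-arc equals the sum of the values on the two under-arcs; it is non-trivial if it takes at least two distinct values (colors). The link $L$ admits non-trivial $p$-colorings if some diagram of $L$ has one. The number $\operatorname{mincol}_p L$ is the minimum, over all diagrams $D$ of $L$, of the least number of distinct colors used by a non-trivial $p$-coloring of $D$. The determinant of $L$ is the absolute value of any minor of size $n-1$ of the matrix of the above system of crossing equations over $\mathbb{Z}$, for any diagram of $L$ with $n$ arcs (and $0$ if the diagram has fewer than $n-1$ crossings); it does not depend on the choices. -/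

import Mathlib

/-!
Links and link diagrams.  A link diagram is taken in general position with respect to a height
function on the plane, so that it is cut by horizontal lines into elementary slices, each holding
one local minimum, one local maximum or one crossing.  Every link diagram is of this form up to
planar isotopy.  A link is an equivalence class of diagrams under planar isotopies and
Reidemeister moves, written out for sliced diagrams.
-/

/-- An elementary slice of a link diagram, read upwards.  All other strands run vertically.
Positions are counted from the left, starting with `0`. -/
inductive Slice where
  /-- A local minimum: two new strands are born, at positions `i` and `i + 1`. -/
  | cup (i : ℕ)
  /-- A local maximum: the strands at positions `i` and `i + 1` are joined and end. -/
  | cap (i : ℕ)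
  /-- A crossing of the strands at positions `i` and `i + 1`.  If `s = true`, the strand from the
  lower left to the upper right is the upper (over-)strand; if `s = false`, the strand from the
  lower right to the upper left is. -/
  | cross (i : ℕ) (s : Bool)

namespace Slice

/-- The position of a slice. -/
def pos : Slice → ℕ
  | cup i => i
  | cap i => i
  | cross i _ => i

/-- The number of strands entering the nontrivial part of a slice from below. -/
def nIn : Slice → ℕ
  | cup _ => 0
  | cap _ => 2
  | cross _ _ => 2

/-- The number of strands leaving the nontrivial part of a slice at the top. -/
def nOut : Slice → ℕ
  | cup _ => 2
  | cap _ => 0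
  | cross _ _ => 2

/-- The same slice, placed at position `j`. -/
def place : Slice → ℕ → Slice
  | cup _, j => cup j
  | cap _, j => cap j
  | cross _ s, j => cross j s

/-- The slice can be put on top of `n` strands. -/
def Fits (x : Slice) (n : ℕ) : Prop := x.pos + x.nIn ≤ n

/-- The number of strands at the top of a slice that has `n` strands at the bottom. -/
def step (x : Slice) (n : ℕ) : ℕ := n - x.nIn + x.nOut

/-- The slice is a crossing. -/
def IsCross : Slice → Prop
  | cross _ _ => True
  | _ => False

/-- Which ends of strands are joined inside a slice without passing under a crossing.  The pair
`(0, j)` is the `j`-th point on the bottom line, `(1, j)` the `j`-th point on the top line. -/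
inductive Joins : Slice → ℕ × ℕ → ℕ × ℕ → Prop
  | left (x : Slice) (j : ℕ) (h : j < x.pos) : Joins x (0, j) (1, j)
  | right (x : Slice) (j : ℕ) : Joins x (0, x.pos + x.nIn + j) (1, x.pos + x.nOut + j)
  | min (i : ℕ) : Joins (cup i) (1, i) (1, i + 1)
  | max (i : ℕ) : Joins (cap i) (0, i) (0, i + 1)
  | over_right (i : ℕ) : Joins (cross i true) (0, i) (1, i + 1)
  | over_left (i : ℕ) : Joins (cross i false) (0, i + 1) (1, i)

/-- Starting from `n` strands, the slices can be stacked and no strand is left at the end. -/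
def Stack : ℕ → List Slice → Prop
  | n, [] => n = 0
  | n, x :: w => x.Fits n ∧ Stack (x.step n) w

/-- The number of strands at the top of a stack of slices that has `n` strands at the bottom. -/
def count : ℕ → List Slice → ℕ
  | n, [] => n
  | n, x :: w => count (x.step n) w

theorem Stack.fits {n : ℕ} {w : List Slice} (h : Stack n w) (k : ℕ) (hk : k < w.length) :
    w[k].Fits (count n (w.take k)) := by
  induction w generalizing n k with
  | nil => simp at hk
  | cons x w ih =>
    cases k with
    | zero => exact h.1
    | succ k => exact ih h.2 k (by simpa using hk)

theorem count_take_succ (n : ℕ) (w : List Slice) (k : ℕ) (hk : k < w.length) :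
    count n (w.take (k + 1)) = w[k].step (count n (w.take k)) := by
  induction w generalizing n k with
  | nil => simp at hk
  | cons x w ih =>
    cases k with
    | zero => simp [count]
    | succ k =>
      have := ih (x.step n) k (by simpa using hk)
      simpa [count] using this

theorem cross_bounds (x : Slice) (n : ℕ) (hx : x.IsCross) (h : x.Fits n) :
    x.pos + 1 < n ∧ x.pos + 1 < x.step n := by
  cases x with
  | cup i => exact hx.elim
  | cap i => exact hx.elim
  | cross i s =>
    simp only [Fits, pos, nIn, nOut, step] at *
    omega

end Slice

/-- A (sliced) link diagram: a stack of elementary slices without strands at bottom and top. -/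
structure LinkDiagram where
  slices : List Slice
  stack : Slice.Stack 0 slices

namespace LinkDiagram

variable (D : LinkDiagram)

/-- The number of points in which the diagram meets the horizontal line below slice `k` (or above
the last slice, if `k` is the number of slices). -/
def width (k : ℕ) : ℕ := Slice.count 0 (D.slices.take k)

/-- The points of the diagram on the horizontal lines: a line and a position on it. -/
def Point : Type := Σ k : Fin (D.slices.length + 1), Fin (D.width k)

instance : Finite D.Point := inferInstanceAs (Finite (Σ _, Fin _))

/-- Two points are joined inside one slice, without passing under a crossing. -/
def Adjacent (P Q : D.Point) : Prop :=
  ∃ (k : ℕ) (hk : k < D.slices.length) (a b : ℕ × ℕ), Slice.Joins D.slices[k] a b ∧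
    (P.1 : ℕ) = k + a.1 ∧ (P.2 : ℕ) = a.2 ∧ (Q.1 : ℕ) = k + b.1 ∧ (Q.2 : ℕ) = b.2

/-- The arcs of the diagram, from undercrossing to undercrossing (or a whole closed curve, if it
never passes under a crossing). -/
def Arc : Type := Quot D.Adjacent

instance : Finite D.Arc := inferInstanceAs (Finite (Quot _))

noncomputable instance : Fintype D.Arc := Fintype.ofFinite _

/-- The crossings of the diagram. -/
def Crossing : Type := {k : Fin D.slices.length // D.slices[k].IsCross}

instance : Finite D.Crossing := inferInstanceAs (Finite {_k // _})

noncomputable instance : Fintype D.Crossing := Fintype.ofFinite _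

/-- The arc through the `j`-th point on the `k`-th horizontal line. -/
def arcAt (k j : ℕ) (hk : k ≤ D.slices.length) (hj : j < D.width k) : D.Arc :=
  Quot.mk _ ⟨⟨k, Nat.lt_succ_of_le hk⟩, ⟨j, hj⟩⟩

theorem crossing_bounds (c : D.Crossing) :
    D.slices[c.1].pos + 1 < D.width c.1 ∧ D.slices[c.1].pos + 1 < D.width (c.1 + 1) := by
  have h₁ := D.stack.fits c.1 c.1.2
  have h₂ := Slice.count_take_succ 0 D.slices c.1 c.1.2
  unfold width
  rw [h₂]
  exact Slice.cross_bounds _ _ c.2 h₁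

/-- The arc at the lower left of a crossing. -/
def lowerLeft (c : D.Crossing) : D.Arc :=
  D.arcAt c.1 D.slices[c.1].pos c.1.2.le (Nat.lt_of_succ_lt (D.crossing_bounds c).1)

/-- The arc at the lower right of a crossing. -/
def lowerRight (c : D.Crossing) : D.Arc :=
  D.arcAt c.1 (D.slices[c.1].pos + 1) c.1.2.le (D.crossing_bounds c).1

/-- The arc at the upper left of a crossing. -/
def upperLeft (c : D.Crossing) : D.Arc :=
  D.arcAt (c.1 + 1) D.slices[c.1].pos c.1.2 (Nat.lt_of_succ_lt (D.crossing_bounds c).2)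

/-- The arc at the upper right of a crossing. -/
def upperRight (c : D.Crossing) : D.Arc :=
  D.arcAt (c.1 + 1) (D.slices[c.1].pos + 1) c.1.2 (D.crossing_bounds c).2

/-- The strand from the lower left to the upper right is the over-strand of the crossing. -/
def RisingOver (c : D.Crossing) : Prop :=
  D.slices[c.1] = Slice.cross D.slices[c.1].pos true

open Classical in
/-- The over-arc at a crossing. -/
noncomputable def overArc (c : D.Crossing) : D.Arc :=
  if D.RisingOver c then D.lowerLeft c else D.lowerRight c

open Classical in
/-- The under-arc that reaches a crossing from below. -/
noncomputable def underLower (c : D.Crossing) : D.Arc :=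
  if D.RisingOver c then D.lowerRight c else D.lowerLeft c

open Classical in
/-- The under-arc that reaches a crossing from above. -/
noncomputable def underUpper (c : D.Crossing) : D.Arc :=
  if D.RisingOver c then D.upperLeft c else D.upperRight c

/-- A Fox `m`-coloring: at each crossing, twice the color of the over-arc is the sum of the colors
of the two under-arcs. -/
def IsColoring (m : ℕ) (f : D.Arc → ZMod m) : Prop :=
  ∀ c : D.Crossing, 2 * f (D.overArc c) = f (D.underLower c) + f (D.underUpper c)

/-- A coloring with at least two distinct colors. -/
def IsNontrivialColoring (m : ℕ) (f : D.Arc → ZMod m) : Prop :=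
  D.IsColoring m f ∧ ∃ a b : D.Arc, f a ≠ f b

/-- The diagram has a non-trivial `m`-coloring. -/
def Colorable (m : ℕ) : Prop := ∃ f : D.Arc → ZMod m, D.IsNontrivialColoring m f

/-- The minimum number of colors in a non-trivial `m`-coloring of the diagram (meaningful if
there is one). -/
noncomputable def minColors (m : ℕ) : ℕ :=
  sInf {n | ∃ f : D.Arc → ZMod m, D.IsNontrivialColoring m f ∧ (Set.range f).ncard = n}

open Classical in
/-- The coloring matrix of the diagram: one row for each crossing, one column for each arc. -/
noncomputable def coloringMatrix : Matrix D.Crossing D.Arc ℤ := fun c a =>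
  (if a = D.overArc c then 2 else 0) - (if a = D.underLower c then 1 else 0)
    - (if a = D.underUpper c then 1 else 0)

/-- The determinant of a diagram with `n` arcs: the common absolute value of the minors of size
`n - 1` of the coloring matrix, written as the greatest common divisor of all of these minors.
(If there are fewer than `n - 1` crossings, there are none with distinct rows, and this is `0`.) -/
noncomputable def det : ℕ :=
  (Finset.univ : Finset ((Fin (Fintype.card D.Arc - 1) → D.Crossing) ×
      (Fin (Fintype.card D.Arc - 1) → D.Arc))).gcd
    fun r => (D.coloringMatrix.submatrix r.1 r.2).det.natAbs

end LinkDiagram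

open Slice in
/-- The local moves on sliced diagrams: planar isotopies and the three Reidemeister moves. -/
inductive LocalMove : List Slice → List Slice → Prop
  /-- Planar isotopy: two distant slices change their heights; `x` lies to the left of `y`. -/
  | comm (x y : Slice) (d : ℕ) :
      LocalMove [x, y.place (x.pos + x.nOut + d)] [y.place (x.pos + x.nIn + d), x]
  /-- Planar isotopy: a minimum cancels with the maximum to its right. -/
  | zigzag_right (i : ℕ) : LocalMove [cup i, cap (i + 1)] []
  /-- Planar isotopy: a minimum cancels with the maximum to its left. -/
  | zigzag_left (i : ℕ) : LocalMove [cup (i + 1), cap i] []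
  /-- Planar isotopy: a crossing slides through a minimum. -/
  | slide_cup (i : ℕ) (s : Bool) : LocalMove [cup i, cross (i + 1) s] [cup (i + 1), cross i !s]
  /-- Planar isotopy: a crossing slides through a maximum. -/
  | slide_cap (i : ℕ) (s : Bool) : LocalMove [cross (i + 1) s, cap i] [cross i !s, cap (i + 1)]
  /-- First Reidemeister move, at a minimum. -/
  | reidemeister_one_cup (i : ℕ) (s : Bool) : LocalMove [cup i, cross i s] [cup i]
  /-- First Reidemeister move, at a maximum. -/
  | reidemeister_one_cap (i : ℕ) (s : Bool) : LocalMove [cross i s, cap i] [cap i]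
  /-- Second Reidemeister move. -/
  | reidemeister_two (i : ℕ) (s : Bool) : LocalMove [cross i s, cross i !s] []
  /-- Third Reidemeister move.  Of the strands that start at `i`, `i + 1`, `i + 2`, the first runs
  over the second iff `s`, the first over the third iff `t`, and the second over the third iff `u`;
  the hypothesis excludes the two cyclic patterns. -/
  | reidemeister_three (i : ℕ) (s t u : Bool) (h : ¬ (s = u ∧ t ≠ s)) :
      LocalMove [cross i s, cross (i + 1) t, cross i u] [cross (i + 1) u, cross i t, cross (i + 1) s]

/-- Two diagrams differ by one local move. -/
def LinkDiagram.Move (D E : LinkDiagram) : Prop :=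
  ∃ u v a b : List Slice, LocalMove a b ∧ D.slices = u ++ a ++ v ∧ E.slices = u ++ b ++ v

/-- A link: a class of diagrams under the equivalence relation generated by the local moves. -/
def Link : Type := Quot LinkDiagram.Move

namespace Link

variable (L : Link)

/-- `D` is a diagram of the link `L`. -/
def IsDiagram (D : LinkDiagram) : Prop := (Quot.mk LinkDiagram.Move D : Link) = L

/-- The determinant of a link, computed from a diagram of it (it does not depend on which). -/
noncomputable def det : ℕ := (Quot.out L : LinkDiagram).det

/-- The link admits non-trivial `m`-colorings: it has a diagram with such a coloring. -/
def Colorable (m : ℕ) : Prop := ∃ D : LinkDiagram, L.IsDiagram D ∧ D.Colorable m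

/-- The minimum number of colors of a link modulo `m` (for a link that admits non-trivial
`m`-colorings): the minimum over its diagrams `D` of the number of colors that a non-trivial
`m`-coloring of `D` needs. -/
noncomputable def mincol (m : ℕ) : ℕ :=
  sInf {n | ∃ D : LinkDiagram, L.IsDiagram D ∧ D.Colorable m ∧ D.minColors m = n}

end Link

/-! The heart is the inequality `p ≤ 2 ^ (n - 1)` for a non-trivial `p`-coloring with `n` colors on
a diagram all of whose rational colorings are constant
(`LinkDiagram.IsNontrivialColoring.le_two_pow`). Five colors or fewer would then give `p ≤ 16`.

Take the crossing equations with the colors, not the arcs, as unknowns, and set the unknown of one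
color, the base color, to zero. This integer system has `n - 1` columns. A rational solution,
composed with the coloring, is a rational coloring vanishing on some arc, hence zero; so some minor
of size `n - 1` is non-zero. Modulo `p` the colors themselves, shifted by the base color, are a
non-zero solution, so `p` divides that minor. Each row is a sum of two differences of (possibly
truncated) unit vectors. Expanding the minor by multilinearity gives `2 ^ (n - 1)` determinants of
incidence type, each at most `1` in absolute value.

It remains to know that a diagram with few colors has only constant rational colorings. The
determinant is read off one chosen diagram, and there a non-zero minor forces this. To pass to any
other diagram, the existence of a non-constant coloring over a ring is shown invariant under the
local moves, using lists of colors on horizontal lines, where each move is a local computation. -/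

/-! ### Bounds for minors of incidence type, and existence of a non-zero maximal minor. -/

/-- Total unimodularity of a directed incidence matrix. Ends `o i`, `a i` outside the range of `c`
belong to deleted columns and contribute nothing. -/
theorem Matrix.abs_det_le_one_of_row_differences {α : Type*} [DecidableEq α] (k : ℕ)
    (c : Fin k → α) (hc : Function.Injective c) (o a : Fin k → α) :
    |(Matrix.of fun i j => (if c j = o i then (1 : ℤ) else 0) - if c j = a i then 1 else 0).det|
      ≤ 1 := by
  induction k with
  | zero => simp
  | succ k ih =>
    set N : Matrix (Fin (k + 1)) (Fin (k + 1)) ℤ :=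
      Matrix.of fun i j => (if c j = o i then (1 : ℤ) else 0) - if c j = a i then 1 else 0 with hN
    -- If no row loses an end, all row sums vanish and the all-ones vector is in the kernel.
    -- Otherwise some row has at most one non-zero entry, which is `±1`, and expansion along it
    -- reduces the size.
    by_cases hall : ∀ i, (∃ j, c j = o i) ∧ ∃ j, c j = a i
    · have : N.det = 0 := by
        refine Matrix.exists_mulVec_eq_zero_iff.mp ⟨fun _ => 1, fun h => ?_, ?_⟩
        · simpa using congrFun h 0
        · ext i
          obtain ⟨⟨j, hj⟩, j', hj'⟩ := hall i
          simp [Matrix.mulVec, dotProduct, hN, ← hj, ← hj', hc.eq_iff]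
      simp [this]
    · obtain ⟨i, hi⟩ := not_forall.mp hall
      have hrow : (∀ j, N i j = 0) ∨ ∃ j, |N i j| = 1 ∧ ∀ j', j' ≠ j → N i j' = 0 := by
        by_cases h1 : ∃ j, c j = o i <;> by_cases h2 : ∃ j, c j = a i
        · exact absurd ⟨h1, h2⟩ hi
        · obtain ⟨j, hj⟩ := h1
          push Not at h2
          exact Or.inr ⟨j, by simp [hN, ← hj, h2], fun j' h => by
            simp [hN, ← hj, h2, hc.eq_iff, h]⟩
        · obtain ⟨j, hj⟩ := h2
          push Not at h1
          exact Or.inr ⟨j, by simp [hN, ← hj, h1], fun j' h => by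
            simp [hN, ← hj, h1, hc.eq_iff, h]⟩
        · push Not at h1 h2
          exact Or.inl fun j => by simp [hN, h1, h2]
      rcases hrow with h | ⟨j, hj, h⟩
      · simp [Matrix.det_eq_zero_of_row_eq_zero i h]
      · rw [Matrix.det_succ_row N i, Finset.sum_eq_single j (fun j' _ hne => by simp [h j' hne])
          (by simp)]
        rw [abs_mul, abs_mul, hj, abs_pow, abs_neg, abs_one, one_pow, one_mul, one_mul]
        exact ih (c ∘ j.succAbove) (hc.comp Fin.succAbove_right_injective)
          (o ∘ i.succAbove) (a ∘ i.succAbove)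

/-- Since `2o - a - b = (o - a) + (o - b)`, multilinearity in the rows gives one incidence
determinant for each of the `2 ^ k` subsets of rows. -/
theorem Matrix.abs_det_le_two_pow_of_row_second_differences {α : Type*} [DecidableEq α] (k : ℕ)
    (c : Fin k → α) (hc : Function.Injective c) (o a b : Fin k → α) :
    |(Matrix.of fun i j => (if c j = o i then (2 : ℤ) else 0) - (if c j = a i then 1 else 0)
      - if c j = b i then 1 else 0).det| ≤ 2 ^ k := by
  have hsplit : (Matrix.of fun i j => (if c j = o i then (2 : ℤ) else 0)
      - (if c j = a i then 1 else 0) - if c j = b i then 1 else 0) =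
      (fun i j => (if c j = o i then (1 : ℤ) else 0) - if c j = a i then 1 else 0) +
      (fun i j => (if c j = o i then (1 : ℤ) else 0) - if c j = b i then 1 else 0) := by
    ext i j
    simp only [Matrix.of_apply, Pi.add_apply]
    split_ifs <;> norm_num
  have hdet := (Matrix.detRowAlternating (R := ℤ) (n := Fin k)).toMultilinearMap.map_add_univ
    (fun i j => (if c j = o i then (1 : ℤ) else 0) - if c j = a i then 1 else 0)
    (fun i j => (if c j = o i then (1 : ℤ) else 0) - if c j = b i then 1 else 0)
  rw [hsplit]
  refine (congrArg abs hdet).le.trans ((Finset.abs_sum_le_sum_abs _ _).trans ?_)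
  refine (Finset.sum_le_card_nsmul _ _ 1 fun s _ => ?_).trans (by simp)
  refine le_of_eq_of_le (congrArg (fun N : Matrix (Fin k) (Fin k) ℤ => |N.det|) ?_)
    (Matrix.abs_det_le_one_of_row_differences k c hc o (s.piecewise a b))
  ext i j
  by_cases h : i ∈ s <;> simp [h, Finset.piecewise]

theorem Matrix.exists_rows_det_ne_zero {K m : Type*} [Field K] [Finite m] (k : ℕ)
    (M : Matrix m (Fin k) K) (hM : ∀ x, M.mulVec x = 0 → x = 0) :
    ∃ r : Fin k → m, (M.submatrix r id).det ≠ 0 := by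
  have := Fintype.ofFinite m
  have hli : LinearIndependent K M.col :=
    Matrix.mulVec_injective_iff.mp fun x y h => sub_eq_zero.mp (hM _ (by
      rw [Matrix.mulVec_sub]; exact sub_eq_zero.mpr h))
  have hrank : Module.finrank K (Submodule.span K (Set.range M.row)) = k := by
    rw [← Matrix.rank_eq_finrank_span_row]
    simpa using hli.rank_matrix
  have hg := Submodule.exists_fun_fin_finrank_span_eq K (Set.range M.row)
  rw [hrank] at hg
  obtain ⟨g, hg, -, hlg⟩ := hg
  choose r hr using hg
  refine ⟨r, ?_⟩
  have hrow : (M.submatrix r id).row = g := funext hr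
  rw [← hrow, Matrix.linearIndependent_rows_iff_isUnit, Matrix.isUnit_iff_isUnit_det] at hlg
  exact hlg.ne_zero

/-! ### Colorings of stacks of slices, as lists of colors on horizontal lines. -/

namespace Slice

/-- A relation between lists, applied after skipping `i` common entries. -/
def ListShift {A : Type*} (R : List A → List A → Prop) : ℕ → List A → List A → Prop
  | 0, s, t => R s t
  | i + 1, s, t => ∃ a s' t', s = a :: s' ∧ t = a :: t' ∧ ListShift R i s' t'

variable {A : Type*}

theorem listShift_add (R : List A → List A → Prop) (i j : ℕ) :
    ListShift R (i + j) = ListShift (ListShift R j) i := by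
  induction i with
  | zero => simp [ListShift]
  | succ i ih => ext s t; rw [Nat.succ_add]; simp [ListShift, ih]

/-- Lets a composite of slices discard the `i` strands to their left, so that every move need only
be checked near position `0`. -/
theorem listShift_comp (R R' : List A → List A → Prop) (i : ℕ) (s t : List A) :
    (∃ u, ListShift R i s u ∧ ListShift R' i u t) ↔
      ListShift (fun s t => ∃ u, R s u ∧ R' u t) i s t := by
  induction i generalizing s t with
  | zero => rfl
  | succ i ih =>
    simp only [ListShift, ← ih]
    constructor
    · rintro ⟨u, ⟨a, s', u', rfl, rfl, h⟩, b, u'', t', hu, rfl, h'⟩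
      simp only [List.cons.injEq] at hu
      obtain ⟨rfl, rfl⟩ := hu
      exact ⟨_, _, _, rfl, rfl, _, h, h'⟩
    · rintro ⟨a, s', t', rfl, rfl, u, h, h'⟩
      exact ⟨a :: u, ⟨_, _, _, rfl, rfl, h⟩, _, _, _, rfl, rfl, h'⟩

theorem ListShift.mono {R R' : List A → List A → Prop} (h : ∀ s t, R s t → R' s t) {i : ℕ}
    {s t : List A} (hR : ListShift R i s t) : ListShift R' i s t := by
  induction i generalizing s t with
  | zero => exact h _ _ hR
  | succ i ih =>
    obtain ⟨a, s', t', hs, ht, h'⟩ := hR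
    exact ⟨a, s', t', hs, ht, ih h'⟩

theorem listShift_eq_iff {n i : ℕ} {s t : List A} :
    ListShift (fun s t => s = t ∧ n ≤ s.length) i s t ↔ s = t ∧ i + n ≤ s.length := by
  induction i generalizing s t with
  | zero => simp [ListShift]
  | succ i ih =>
    simp only [ListShift, ih]
    constructor
    · rintro ⟨a, s', t', rfl, rfl, rfl, h⟩
      exact ⟨rfl, by simp; omega⟩
    · rintro ⟨rfl, h⟩
      cases s with
      | nil => simp at h
      | cons a s => exact ⟨a, s, s, rfl, rfl, rfl, by simpa [Nat.succ_add] using h⟩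

variable [CommRing A]

/-- The colors below and above a slice at position `0`. -/
def BaseColors : Slice → List A → List A → Prop
  | cup _, s, t => ∃ a, t = a :: a :: s
  | cap _, s, t => ∃ a, s = a :: a :: t
  | cross _ true, s, t => ∃ a b r, s = a :: b :: r ∧ t = (2 * a - b) :: a :: r
  | cross _ false, s, t => ∃ a b r, s = a :: b :: r ∧ t = b :: (2 * b - a) :: r

/-- The lists of colors on the lines below and above a slice belong to a coloring of it. -/
def Colors (x : Slice) : List A → List A → Prop := ListShift (BaseColors x) x.pos

/-- A stack of slices has a coloring with colors `s` at the bottom, `t` at the top, and `N` as the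
set of all colors. -/
def StackColors : List Slice → List A → List A → Set A → Prop
  | [], s, t, N => s = t ∧ N = {c | c ∈ s}
  | x :: w, s, t, N => ∃ u N', Colors x s u ∧ StackColors w u t N' ∧ N = {c | c ∈ s} ∪ N'

theorem Colors.length {x : Slice} {s t : List A} (h : Colors x s t) :
    t.length = x.step s.length := by
  unfold Colors at h
  have : ∀ i, ListShift (BaseColors x) i s t → x.nIn ≤ s.length ∧
      t.length = s.length - x.nIn + x.nOut := by
    clear h
    intro i h
    induction i generalizing s t with
    | zero =>
      rcases x with i | i | ⟨i, _ | _⟩ <;> simp only [ListShift, BaseColors] at h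
      · obtain ⟨a, rfl⟩ := h; simp [nIn, nOut]
      · obtain ⟨a, rfl⟩ := h; simp [nIn, nOut]
      · obtain ⟨a, b, r, rfl, rfl⟩ := h; simp [nIn, nOut]
      · obtain ⟨a, b, r, rfl, rfl⟩ := h; simp [nIn, nOut]
    | succ i ih =>
      obtain ⟨a, s', t', rfl, rfl, h'⟩ := h
      have := ih h'
      simp only [List.length_cons]
      omega
  exact (this _ h).2

theorem StackColors.length {w : List Slice} {s t : List A} {N : Set A}
    (h : StackColors w s t N) : t.length = count s.length w := by
  induction w generalizing s N with
  | nil => rw [h.1]; rfl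
  | cons x w ih =>
    obtain ⟨u, N', hx, hw, -⟩ := h
    rw [ih hw, hx.length, count]

theorem StackColors.subset {w : List Slice} {s t : List A} {N : Set A}
    (h : StackColors w s t N) : {c | c ∈ s} ⊆ N ∧ {c | c ∈ t} ⊆ N := by
  induction w generalizing s N with
  | nil => rw [h.2, h.1]; simp
  | cons x w ih =>
    obtain ⟨u, N', hx, hw, rfl⟩ := h
    exact ⟨Set.subset_union_left, (ih hw).2.trans Set.subset_union_right⟩

theorem stackColors_append {v w : List Slice} {s t : List A} {N : Set A} :
    StackColors (v ++ w) s t N ↔ ∃ u N₁ N₂, StackColors v s u N₁ ∧ StackColors w u t N₂ ∧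
      N = N₁ ∪ N₂ := by
  induction v generalizing s N with
  | nil =>
    constructor
    · intro h
      refine ⟨s, _, N, ⟨rfl, rfl⟩, h, ?_⟩
      rw [Set.union_eq_self_of_subset_left h.subset.1]
    · rintro ⟨u, N₁, N₂, ⟨rfl, rfl⟩, h, rfl⟩
      rw [Set.union_eq_self_of_subset_left h.subset.1]
      exact h
  | cons x v ih =>
    constructor
    · rintro ⟨u, N', hx, h, rfl⟩
      obtain ⟨u', N₁, N₂, h₁, h₂, rfl⟩ := ih.mp h
      exact ⟨u', _, N₂, ⟨u, N₁, hx, h₁, rfl⟩, h₂, (Set.union_assoc _ _ _).symm⟩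
    · rintro ⟨u', _, N₂, ⟨u, N₁, hx, h₁, rfl⟩, h₂, rfl⟩
      exact ⟨u, _, hx, ih.mpr ⟨u', N₁, N₂, h₁, h₂, rfl⟩, Set.union_assoc _ _ _⟩

theorem Stack.append {n : ℕ} {v w : List Slice} (h : Stack n (v ++ w)) : Stack (count n v) w := by
  induction v generalizing n with
  | nil => exact h
  | cons x v ih => exact ih h.2

end Slice

/-! ### Reduction of short stacks to position zero, and rewriting rules there. -/

namespace Slice

variable {A : Type*} [CommRing A]

theorem colors_eq_listShift (x : Slice) (i j : ℕ) (h : x.pos = i + j) :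
    (Colors x : List A → List A → Prop) = ListShift (ListShift (BaseColors x) j) i := by
  rw [Colors, h, listShift_add]

theorem stackColors_pair_iff {x y : Slice} {s t : List A} (i j k : ℕ) (hx : x.pos = i + j)
    (hy : y.pos = i + k) :
    (∃ N, StackColors [x, y] s t N) ↔ ListShift (fun s t =>
      ∃ u, ListShift (BaseColors x) j s u ∧ ListShift (BaseColors y) k u t) i s t := by
  rw [← listShift_comp, ← colors_eq_listShift x i j hx, ← colors_eq_listShift y i k hy]
  constructor
  · rintro ⟨N, u, N', h, ⟨u', N'', h', ⟨rfl, -⟩, -⟩, -⟩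
    exact ⟨u, h, h'⟩
  · rintro ⟨u, h, h'⟩
    exact ⟨_, u, _, h, ⟨_, _, h', ⟨rfl, rfl⟩, rfl⟩, rfl⟩

theorem stackColors_triple_iff {x y z : Slice} {s t : List A} (i j k l : ℕ) (hx : x.pos = i + j)
    (hy : y.pos = i + k) (hz : z.pos = i + l) :
    (∃ N, StackColors [x, y, z] s t N) ↔ ListShift (fun s t => ∃ u,
      ListShift (BaseColors x) j s u ∧ ∃ u', ListShift (BaseColors y) k u u' ∧
        ListShift (BaseColors z) l u' t) i s t := by
  rw [← listShift_comp, ← colors_eq_listShift x i j hx]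
  simp only [← listShift_comp]
  rw [← colors_eq_listShift y i k hy, ← colors_eq_listShift z i l hz]
  constructor
  · rintro ⟨N, u, N', h, ⟨u', N'', h', ⟨u'', N''', h'', ⟨rfl, -⟩, -⟩, -⟩, -⟩
    exact ⟨u, h, u', h', h''⟩
  · rintro ⟨u, h, u', h', h''⟩
    exact ⟨_, u, _, h, ⟨_, _, h', ⟨_, _, h'', ⟨rfl, rfl⟩, rfl⟩, rfl⟩, rfl⟩

theorem stackColors_singleton_iff {x : Slice} {s t : List A} (i j : ℕ) (hx : x.pos = i + j) :
    (∃ N, StackColors [x] s t N) ↔ ListShift (ListShift (BaseColors x) j) i s t := by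
  rw [← colors_eq_listShift x i j hx]
  constructor
  · rintro ⟨N, u, N', h, ⟨rfl, -⟩, -⟩
    exact h
  · exact fun h => ⟨_, _, _, h, ⟨rfl, rfl⟩, rfl⟩

/-- The length condition records that the strands of the removed pattern exist; without it the
identity at position `0` would not match the other side of the move. -/
theorem stackColors_nil_iff {s t : List A} (i n : ℕ) (h : i + n ≤ s.length) :
    (∃ N, StackColors [] s t N) ↔ ListShift (fun s t => s = t ∧ n ≤ s.length) i s t := by
  rw [listShift_eq_iff]
  exact ⟨fun ⟨_, h', _⟩ => ⟨h', h⟩, fun h' => ⟨_, h'.1, rfl⟩⟩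

omit [CommRing A] in
theorem listShift_congr {R R' : List A → List A → Prop} (h : ∀ s t, R s t ↔ R' s t) {i : ℕ}
    {s t : List A} : ListShift R i s t ↔ ListShift R' i s t :=
  ⟨ListShift.mono fun s t => (h s t).mp, ListShift.mono fun s t => (h s t).mpr⟩

theorem baseColors_place (y : Slice) (j : ℕ) :
    (BaseColors (y.place j) : List A → List A → Prop) = BaseColors y := by
  rcases y with _ | _ | ⟨_, _ | _⟩ <;> rfl

theorem pos_place (y : Slice) (j : ℕ) : (y.place j).pos = j := by
  cases y <;> rfl

theorem baseColors_comm (x : Slice) (R : List A → List A → Prop) (s t : List A) :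
    (∃ u, BaseColors x s u ∧ ListShift R x.nOut u t) ↔
      ∃ u, ListShift R x.nIn s u ∧ BaseColors x u t := by
  rcases x with i | i | ⟨i, _ | _⟩ <;> simp only [nIn, nOut, ListShift, BaseColors] <;>
    grind

omit [CommRing A] in
theorem listShift_zero (R : List A → List A → Prop) (s t : List A) :
    ListShift R 0 s t ↔ R s t := Iff.rfl

omit [CommRing A] in
theorem listShift_succ_nil (R : List A → List A → Prop) (i : ℕ) (t : List A) :
    ListShift R (i + 1) [] t ↔ False := by
  simp [ListShift]

omit [CommRing A] in
theorem listShift_succ_cons (R : List A → List A → Prop) (i : ℕ) (a : A) (s t : List A) :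
    ListShift R (i + 1) (a :: s) t ↔ ∃ t', ListShift R i s t' ∧ t = a :: t' := by
  simp only [ListShift, List.cons.injEq]
  grind

theorem baseColors_cup (i : ℕ) (s t : List A) :
    BaseColors (cup i) s t ↔ ∃ a, t = a :: a :: s := Iff.rfl

theorem baseColors_cap_nil (i : ℕ) (t : List A) : BaseColors (cap i) [] t ↔ False := by
  simp [BaseColors]

theorem baseColors_cap_singleton (i : ℕ) (a : A) (t : List A) :
    BaseColors (cap i) [a] t ↔ False := by
  simp [BaseColors]

theorem baseColors_cap_cons (i : ℕ) (a b : A) (s t : List A) :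
    BaseColors (cap i) (a :: b :: s) t ↔ a = b ∧ t = s := by
  simp only [BaseColors, List.cons.injEq]
  grind

theorem baseColors_cross_nil (i : ℕ) (s : Bool) (t : List A) :
    BaseColors (cross i s) [] t ↔ False := by
  cases s <;> simp [BaseColors]

theorem baseColors_cross_singleton (i : ℕ) (s : Bool) (a : A) (t : List A) :
    BaseColors (cross i s) [a] t ↔ False := by
  cases s <;> simp [BaseColors]

theorem baseColors_cross_true_cons (i : ℕ) (a b : A) (s t : List A) :
    BaseColors (cross i true) (a :: b :: s) t ↔ t = (2 * a - b) :: a :: s := by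
  simp only [BaseColors, List.cons.injEq]
  grind

theorem baseColors_cross_false_cons (i : ℕ) (a b : A) (s t : List A) :
    BaseColors (cross i false) (a :: b :: s) t ↔ t = b :: (2 * b - a) :: s := by
  simp only [BaseColors, List.cons.injEq]
  grind

end Slice

/-! ### Local moves preserve the possible boundary colors. -/

section

open Slice

/-- Only the boundary colors are compared, since a move may change the set of colors inside. The
stack hypotheses supply the strands needed when one side of a move is empty. -/
theorem LocalMove.exists_stackColors_iff {A : Type*} [CommRing A] {a b v v' : List Slice}
    (h : LocalMove a b) {s t : List A} (ha : Stack s.length (a ++ v))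
    (hb : Stack s.length (b ++ v')) :
    (∃ N, StackColors a s t N) ↔ ∃ N, StackColors b s t N := by
  cases h with
  | comm x y d =>
    rw [stackColors_pair_iff x.pos 0 (x.nOut + d) rfl (by rw [pos_place, add_assoc]),
      stackColors_pair_iff x.pos (x.nIn + d) 0 (by rw [pos_place, add_assoc]) rfl]
    refine listShift_congr fun s t => ?_
    simp only [listShift_add, baseColors_place]
    exact baseColors_comm x _ s t
  | zigzag_right i =>
    have hi : i + 1 ≤ s.length := by
      have := ha.2.1
      simp [Fits, step, pos, nIn, nOut] at this
      omega
    rw [stackColors_pair_iff i 0 1 rfl rfl, stackColors_nil_iff i 1 hi]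
    refine listShift_congr fun s t => ?_
    rcases s with _ | ⟨a, _ | ⟨b, _ | ⟨c, s⟩⟩⟩ <;>
      simp only [listShift_zero, listShift_succ_cons, baseColors_cup, baseColors_cap_singleton,
        baseColors_cap_cons, ↓existsAndEq, true_and, false_and, and_false, exists_false] <;> grind
  | zigzag_left i =>
    have hi : i + 1 ≤ s.length := ha.1
    rw [stackColors_pair_iff i 1 0 rfl rfl, stackColors_nil_iff i 1 hi]
    refine listShift_congr fun s t => ?_
    rcases s with _ | ⟨a, _ | ⟨b, _ | ⟨c, s⟩⟩⟩ <;>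
      simp only [listShift_zero, listShift_succ_nil, listShift_succ_cons, baseColors_cup,
        baseColors_cap_cons, ↓existsAndEq, true_and, false_and, exists_false] <;> grind
  | slide_cup i s =>
    rw [stackColors_pair_iff i 0 1 rfl rfl, stackColors_pair_iff i 1 0 rfl rfl]
    refine listShift_congr fun s t => ?_
    rcases s with _ | ⟨a, _ | ⟨b, s⟩⟩ <;>
      cases ‹Bool› <;>
      simp only [listShift_zero, listShift_succ_nil, listShift_succ_cons, baseColors_cup,
        baseColors_cross_singleton, baseColors_cross_true_cons, baseColors_cross_false_cons,
        ↓existsAndEq, exists_eq_left, true_and, false_and, and_false, two_mul, exists_false,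
        Bool.not_true, Bool.not_false]
    all_goals
      -- Here the strand colored `a` runs over the minimum, whose color is therefore reflected in
      -- `a`.
      constructor <;> rintro ⟨x, rfl⟩ <;> exact ⟨a + a - x, by simp⟩
  | slide_cap i s =>
    rw [stackColors_pair_iff i 1 0 rfl rfl, stackColors_pair_iff i 0 1 rfl rfl]
    refine listShift_congr fun s t => ?_
    rcases s with _ | ⟨a, _ | ⟨b, _ | ⟨c, s⟩⟩⟩ <;>
      cases ‹Bool› <;>
      simp only [listShift_zero, listShift_succ_nil, listShift_succ_cons,
        baseColors_cap_singleton, baseColors_cap_cons, baseColors_cross_nil,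
        baseColors_cross_singleton, baseColors_cross_true_cons, baseColors_cross_false_cons,
        ↓existsAndEq, exists_eq_left, false_and, two_mul, exists_false, Bool.not_true,
        Bool.not_false] <;> grind
  | reidemeister_one_cup i s =>
    rw [stackColors_pair_iff i 0 0 rfl rfl, stackColors_singleton_iff i 0 rfl]
    refine listShift_congr fun s t => ?_
    cases ‹Bool› <;>
      simp only [listShift_zero, baseColors_cup, baseColors_cross_true_cons,
        baseColors_cross_false_cons, ↓existsAndEq, true_and, two_mul, add_sub_cancel_right]
  | reidemeister_one_cap i s =>
    rw [stackColors_pair_iff i 0 0 rfl rfl, stackColors_singleton_iff i 0 rfl]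
    refine listShift_congr fun s t => ?_
    rcases s with _ | ⟨a, _ | ⟨b, _ | ⟨c, s⟩⟩⟩ <;>
      cases ‹Bool› <;>
      simp only [listShift_zero, baseColors_cap_nil, baseColors_cap_singleton,
        baseColors_cap_cons, baseColors_cross_nil, baseColors_cross_singleton,
        baseColors_cross_true_cons, baseColors_cross_false_cons, exists_eq_left, false_and,
        two_mul, exists_false] <;> grind
  | reidemeister_two i s =>
    have hi : i + 2 ≤ _ := ha.1
    rw [stackColors_pair_iff i 0 0 rfl rfl, stackColors_nil_iff i 2 hi]
    refine listShift_congr fun s t => ?_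
    rcases s with _ | ⟨a, _ | ⟨b, _ | ⟨c, s⟩⟩⟩ <;>
      cases ‹Bool› <;>
      simp only [listShift_zero, baseColors_cross_nil, baseColors_cross_singleton,
        baseColors_cross_true_cons, baseColors_cross_false_cons, exists_eq_left, false_and,
        two_mul, sub_sub_cancel, exists_false, Bool.not_true, Bool.not_false] <;> grind
  | reidemeister_three i s t u h =>
    rw [stackColors_triple_iff i 0 1 0 rfl rfl rfl, stackColors_triple_iff i 1 0 1 rfl rfl rfl]
    refine listShift_congr fun s' t' => ?_
    rcases s' with _ | ⟨a, _ | ⟨b, _ | ⟨c, s'⟩⟩⟩ <;> cases s <;> cases t <;> cases u <;>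
      first
      | exact absurd ⟨rfl, by decide⟩ h
      | clear h
        simp only [listShift_zero, listShift_succ_nil, listShift_succ_cons, baseColors_cross_nil,
          baseColors_cross_singleton, baseColors_cross_true_cons, baseColors_cross_false_cons,
          exists_eq_left, false_and, two_mul, exists_false]
    all_goals
      refine Eq.congr_right ?_
      simp only [List.cons.injEq, and_true, true_and]
      try constructor
      all_goals ring

end

/-! ### Constancy inside a local piece is forced by constancy on its boundary. -/

namespace Slice

variable {A : Type*} [CommRing A]

omit [CommRing A] in
theorem listShift_subset {R : List A → List A → Prop} {c : A}
    (hR : ∀ s t, R s t → (∀ x ∈ s, x = c) → ∀ x ∈ t, x = c) {i : ℕ} {s t : List A}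
    (h : ListShift R i s t) : (∀ x ∈ s, x = c) → ∀ x ∈ t, x = c := by
  induction i generalizing s t with
  | zero => exact hR _ _ h
  | succ i ih =>
    obtain ⟨a, s', t', rfl, rfl, h'⟩ := h
    intro hs
    simp only [List.mem_cons, forall_eq_or_imp] at hs ⊢
    exact ⟨hs.1, ih h' hs.2⟩

/-- A slice other than a minimum has only one color if it has only one color at the bottom. -/
theorem Colors.top_eq {x : Slice} {s t : List A} {c : A} (h : Colors x s t) (hx : 0 < x.nIn)
    (hs : ∀ y ∈ s, y = c) : ∀ y ∈ t, y = c := by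
  refine listShift_subset (fun s t h => ?_) h hs
  rcases x with i | i | ⟨i, _ | _⟩ <;> simp only [BaseColors] at h
  · simp [nIn] at hx
  · obtain ⟨a, rfl⟩ := h
    simp +contextual
  · obtain ⟨a, b, r, rfl, rfl⟩ := h
    simp +contextual [two_mul]
  · obtain ⟨a, b, r, rfl, rfl⟩ := h
    simp +contextual [two_mul]

omit [CommRing A] in
theorem listShift_swap {R : List A → List A → Prop} {i : ℕ} {s t : List A} :
    ListShift R i s t ↔ ListShift (fun s t => R t s) i t s := by
  induction i generalizing s t with
  | zero => rfl
  | succ i ih =>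
    simp only [ListShift, ih]
    constructor <;> rintro ⟨a, s', t', rfl, rfl, h⟩ <;> exact ⟨a, _, _, rfl, rfl, h⟩

/-- A slice other than a maximum has only one color if it has only one color at the top. -/
theorem Colors.bottom_eq {x : Slice} {s t : List A} {c : A} (h : Colors x s t) (hx : 0 < x.nOut)
    (ht : ∀ y ∈ t, y = c) : ∀ y ∈ s, y = c := by
  refine listShift_subset (fun s t h => ?_) (listShift_swap.mp h) ht
  rcases x with i | i | ⟨i, _ | _⟩ <;> simp only [BaseColors] at h
  · obtain ⟨a, rfl⟩ := h
    simp +contextual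
  · simp [nOut] at hx
  · obtain ⟨a, b, r, rfl, rfl⟩ := h
    simp only [List.mem_cons, forall_eq_or_imp, and_imp]
    grind
  · obtain ⟨a, b, r, rfl, rfl⟩ := h
    simp only [List.mem_cons, forall_eq_or_imp, and_imp]
    grind

/-- All colorings of a stack of slices that are constant at the bottom and at the top are
constant. -/
def BoundaryDetermined (A : Type*) [CommRing A] (w : List Slice) : Prop :=
  ∀ (s t : List A) (N : Set A) (c : A), StackColors w s t N → (∀ x ∈ s, x = c) →
    (∀ x ∈ t, x = c) → ∀ x ∈ N, x = c

theorem boundaryDetermined_nil : BoundaryDetermined A [] := by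
  rintro s t N c ⟨rfl, rfl⟩ hs - x hx
  exact hs x hx

theorem BoundaryDetermined.cons {x : Slice} {w : List Slice} (hx : 0 < x.nIn)
    (hw : BoundaryDetermined A w) : BoundaryDetermined A (x :: w) := by
  rintro s t N c ⟨u, N', h, h', rfl⟩ hs ht y (hy | hy)
  · exact hs y hy
  · exact hw u t N' c h' (h.top_eq hx hs) ht y hy

theorem boundaryDetermined_singleton (x : Slice) : BoundaryDetermined A [x] := by
  rintro s t N c ⟨u, N', h, ⟨rfl, rfl⟩, rfl⟩ hs ht y (hy | hy)
  · exact hs y hy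
  · exact ht y hy

theorem boundaryDetermined_pair {x y : Slice} (h : ∀ (s u t : List A) (c : A), Colors x s u →
    Colors y u t → (∀ z ∈ s, z = c) → (∀ z ∈ t, z = c) → ∀ z ∈ u, z = c) :
    BoundaryDetermined A [x, y] := by
  rintro s t N c ⟨u, N', h₁, ⟨u', N'', h₂, ⟨rfl, rfl⟩, rfl⟩, rfl⟩ hs ht z (hz | hz | hz)
  · exact hs z hz
  · exact h s u u' c h₁ h₂ hs ht z hz
  · exact ht z hz

theorem boundaryDetermined_pair_of_nOut_pos {x y : Slice} (hy : 0 < y.nOut) :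
    BoundaryDetermined A [x, y] :=
  boundaryDetermined_pair fun _ _ _ _ _ h₂ _ ht => h₂.bottom_eq hy ht

theorem boundaryDetermined_pair_of_base {x y : Slice} (i j k : ℕ) (hx : x.pos = i + j)
    (hy : y.pos = i + k) (h : ∀ (s u t : List A) (c : A), ListShift (BaseColors x) j s u →
    ListShift (BaseColors y) k u t → (∀ z ∈ s, z = c) → (∀ z ∈ t, z = c) → ∀ z ∈ u, z = c) :
    BoundaryDetermined A [x, y] := by
  refine boundaryDetermined_pair fun s u t c => ?_
  rw [colors_eq_listShift x i j hx, colors_eq_listShift y i k hy]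
  clear hx hy
  induction i generalizing s u t with
  | zero => exact h s u t c
  | succ i ih =>
    rintro ⟨a, s', u', rfl, rfl, h₁⟩ ⟨b, u'', t', hu, rfl, h₂⟩ hs ht
    simp only [List.cons.injEq] at hu
    obtain ⟨rfl, rfl⟩ := hu
    simp only [List.mem_cons, forall_eq_or_imp] at hs ht ⊢
    exact ⟨hs.1, ih _ _ _ h₁ h₂ hs.2 ht.2⟩

end Slice

section

open Slice

/-- No side of a move contains a closed component, so a constant color on the boundary propagates
inwards, upwards through slices other than minima and downwards through slices other than maxima. -/
theorem LocalMove.boundaryDetermined {A : Type*} [CommRing A] {a b : List Slice}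
    (h : LocalMove a b) : BoundaryDetermined A a ∧ BoundaryDetermined A b := by
  cases h with
  | comm x y d =>
    constructor
    · refine boundaryDetermined_pair_of_base x.pos 0 (x.nOut + d) rfl
        (by rw [pos_place, add_assoc]) fun s u t c hx hy hs ht => ?_
      rcases x with i | i | ⟨i, _ | _⟩
      · obtain ⟨a, rfl⟩ := hx
        -- The slice `y` skips both new strands, so the color of the minimum reaches the top line.
        obtain ⟨b, u', t', hu, rfl, h'⟩ : ListShift _ (1 + d + 1) _ _ := by
          convert hy using 1; simp [nOut]; omega
        simp only [List.cons.injEq] at hu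
        obtain ⟨rfl, rfl⟩ := hu
        simp only [List.mem_cons, forall_eq_or_imp] at ht ⊢
        exact ⟨ht.1, ht.1, hs⟩
      · exact Colors.top_eq (x := cap 0) hx two_pos hs
      · exact Colors.top_eq (x := cross 0 false) hx two_pos hs
      · exact Colors.top_eq (x := cross 0 true) hx two_pos hs
    · refine boundaryDetermined_pair_of_base x.pos (x.nIn + d) 0
        (by rw [pos_place, add_assoc]) rfl fun s u t c hy hx hs ht => ?_
      rcases x with i | i | ⟨i, _ | _⟩
      · obtain ⟨a, rfl⟩ := hx
        simp only [List.mem_cons, forall_eq_or_imp] at ht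
        exact ht.2.2
      · obtain ⟨a, rfl⟩ := hx
        obtain ⟨b, s', u', rfl, hu, h'⟩ : ListShift _ (1 + d + 1) _ _ := by
          convert hy using 1; simp [nIn]; omega
        simp only [List.cons.injEq] at hu
        obtain ⟨rfl, rfl⟩ := hu
        simp only [List.mem_cons, forall_eq_or_imp] at hs ⊢
        exact ⟨hs.1, hs.1, ht⟩
      · exact Colors.bottom_eq (x := cross 0 false) hx two_pos ht
      · exact Colors.bottom_eq (x := cross 0 true) hx two_pos ht
  | zigzag_right i =>
    refine ⟨boundaryDetermined_pair_of_base i 0 1 rfl rfl fun s u t c hx hy hs ht => ?_,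
      boundaryDetermined_nil⟩
    simp only [ListShift, BaseColors] at hx hy
    grind
  | zigzag_left i =>
    refine ⟨boundaryDetermined_pair_of_base i 1 0 rfl rfl fun s u t c hx hy hs ht => ?_,
      boundaryDetermined_nil⟩
    simp only [ListShift, BaseColors] at hx hy
    grind
  | slide_cup i s =>
    exact ⟨boundaryDetermined_pair_of_nOut_pos two_pos,
      boundaryDetermined_pair_of_nOut_pos two_pos⟩
  | slide_cap i s =>
    exact ⟨(boundaryDetermined_singleton _).cons two_pos,
      (boundaryDetermined_singleton _).cons two_pos⟩
  | reidemeister_one_cup i s =>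
    exact ⟨boundaryDetermined_pair_of_nOut_pos two_pos, boundaryDetermined_singleton _⟩
  | reidemeister_one_cap i s =>
    exact ⟨(boundaryDetermined_singleton _).cons two_pos, boundaryDetermined_singleton _⟩
  | reidemeister_two i s =>
    exact ⟨(boundaryDetermined_singleton _).cons two_pos, boundaryDetermined_nil⟩
  | reidemeister_three i s t u h =>
    exact ⟨((boundaryDetermined_singleton _).cons two_pos).cons two_pos,
      ((boundaryDetermined_singleton _).cons two_pos).cons two_pos⟩

/-! ### Invariance of the existence of non-constant colorings. -/

namespace LinkDiagram

/-- The diagram has a coloring, in terms of its horizontal sections, with more than one color. -/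
def HasNonconstantStackColors (A : Type*) [CommRing A] (D : LinkDiagram) : Prop :=
  ∃ N : Set A, StackColors D.slices [] [] N ∧ ∀ c, ∃ x ∈ N, x ≠ c

theorem HasNonconstantStackColors.replace {A : Type*} [CommRing A] {D E : LinkDiagram}
    {u v a b : List Slice} (hD : D.slices = u ++ (a ++ v)) (hE : E.slices = u ++ (b ++ v))
    (hab : ∀ s t : List A, Stack s.length (a ++ v) → Stack s.length (b ++ v) →
      (∃ N, StackColors a s t N) → ∃ N, StackColors b s t N)
    (ha : BoundaryDetermined A a) (h : D.HasNonconstantStackColors A) :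
    E.HasNonconstantStackColors A := by
  obtain ⟨N, hN, hne⟩ := h
  have hSD := D.stack
  have hSE := E.stack
  rw [hD, stackColors_append] at hN
  rw [hD] at hSD
  rw [hE] at hSE
  obtain ⟨s, N₁, N', h₁, hN', rfl⟩ := hN
  obtain ⟨t, N₂, N₃, h₂, h₃, rfl⟩ := stackColors_append.mp hN'
  have hlen : s.length = count 0 u := h₁.length
  obtain ⟨M, hM⟩ := hab s t (hlen ▸ hSD.append) (hlen ▸ hSE.append) ⟨_, h₂⟩
  refine ⟨N₁ ∪ (M ∪ N₃), ?_, fun c => ?_⟩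
  · rw [hE]
    exact stackColors_append.mpr ⟨s, _, _, h₁, stackColors_append.mpr ⟨t, _, _, hM, h₃, rfl⟩, rfl⟩
  -- If the new coloring were constant, the boundary of the old piece `a` would be too, hence also
  -- its interior and the whole old coloring.
  · by_contra! hc
    obtain ⟨x, hx, hxc⟩ := hne c
    refine hxc ?_
    rcases hx with hx | hx | hx
    · exact hc x (Or.inl hx)
    · exact ha s t N₂ c h₂ (fun y hy => hc y (Or.inl (h₁.subset.2 hy)))
        (fun y hy => hc y (Or.inr (Or.inr (h₃.subset.1 hy)))) x hx
    · exact hc x (Or.inr (Or.inr hx))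

theorem Move.hasNonconstantStackColors_iff {A : Type*} [CommRing A] {D E : LinkDiagram}
    (h : D.Move E) : D.HasNonconstantStackColors A ↔ E.HasNonconstantStackColors A := by
  obtain ⟨u, v, a, b, hab, hD, hE⟩ := h
  rw [List.append_assoc] at hD hE
  exact ⟨.replace hD hE (fun s t h₁ h₂ => (hab.exists_stackColors_iff h₁ h₂).mp)
      hab.boundaryDetermined.1,
    .replace hE hD (fun s t h₁ h₂ => (hab.exists_stackColors_iff h₂ h₁).mpr)
      hab.boundaryDetermined.2⟩

end LinkDiagram

theorem Link.IsDiagram.hasNonconstantStackColors_iff {A : Type*} [CommRing A] {L : Link}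
    {D E : LinkDiagram} (hD : L.IsDiagram D) (hE : L.IsDiagram E) :
    D.HasNonconstantStackColors A ↔ E.HasNonconstantStackColors A := by
  have h := Quot.eqvGen_exact (hD.trans hE.symm)
  clear hD hE
  induction h with
  | rel _ _ h => exact h.hasNonconstantStackColors_iff
  | refl => rfl
  | symm _ _ _ ih => exact ih.symm
  | trans _ _ _ _ _ ih₁ ih₂ => exact ih₁.trans ih₂

end

/-! ### Colors on lines correspond to colors on arcs. -/

namespace Slice

variable {A : Type*} [CommRing A]

/-- The conditions on the colors `a`, `b` (lower left and right) and `c`, `d` (upper left and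
right) at the nontrivial part of a slice. -/
def LocalColors : Slice → A → A → A → A → Prop
  | cup _, _, _, c, d => c = d
  | cap _, a, b, _, _ => a = b
  | cross _ true, a, b, c, d => a = d ∧ 2 * a = b + c
  | cross _ false, a, b, c, d => b = c ∧ 2 * b = a + d

omit [CommRing A] in
theorem list_eq_of_getD [Zero A] {s t : List A} (hl : s.length = t.length)
    (h : ∀ j, s.getD j 0 = t.getD j 0) : s = t := by
  refine List.ext_getElem hl fun j h₁ h₂ => ?_
  simpa [h₁, h₂] using h j

/-- An entrywise form, matching points of a diagram. Entries past the end read as `0`; the length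
conditions keep this default harmless. -/
theorem baseColors_iff_getD (x : Slice) (s t : List A) :
    BaseColors x s t ↔ x.nIn ≤ s.length ∧ t.length + x.nIn = s.length + x.nOut ∧
      (∀ j, s.getD (x.nIn + j) 0 = t.getD (x.nOut + j) 0) ∧
      x.LocalColors (s.getD 0 0) (s.getD 1 0) (t.getD 0 0) (t.getD 1 0) := by
  constructor
  · intro h
    rcases x with i | i | ⟨i, _ | _⟩
    · obtain ⟨a, rfl⟩ := h
      simp [nIn, nOut, LocalColors, Nat.add_comm 2]
    · obtain ⟨a, rfl⟩ := h
      simp [nIn, nOut, LocalColors, Nat.add_comm 2]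
    · obtain ⟨a, b, r, rfl, rfl⟩ := h
      simp [nIn, nOut, LocalColors, Nat.add_comm 2]
    · obtain ⟨a, b, r, rfl, rfl⟩ := h
      simp [nIn, nOut, LocalColors, Nat.add_comm 2]
  · rintro ⟨h₁, h₂, h₃, h₄⟩
    rcases x with i | i | ⟨i, _ | _⟩
    · rcases t with _ | ⟨a, _ | ⟨b, t⟩⟩ <;> simp [nIn, nOut] at h₂
      simp [nIn, nOut, Nat.add_comm 2] at h₃
      have : t = s := list_eq_of_getD h₂ fun j => by simp [h₃]
      simp [LocalColors] at h₄
      simp [BaseColors, this, h₄]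
    · rcases s with _ | ⟨a, _ | ⟨b, s⟩⟩ <;> simp [nIn, nOut] at h₁ h₂
      simp [nIn, nOut, Nat.add_comm 2] at h₃
      have : t = s := list_eq_of_getD h₂ fun j => by simp [h₃]
      simp [LocalColors] at h₄
      simp [BaseColors, this, h₄]
    · rcases s with _ | ⟨a, _ | ⟨b, s⟩⟩ <;> simp [nIn] at h₁
      rcases t with _ | ⟨c, _ | ⟨d, t⟩⟩ <;> simp [nIn, nOut] at h₂
      simp [nIn, nOut, Nat.add_comm 2] at h₃
      have : t = s := list_eq_of_getD h₂ fun j => by simp [h₃]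
      simp [LocalColors] at h₄
      obtain ⟨rfl, h₅⟩ := h₄
      simp [BaseColors, this, h₅]
    · rcases s with _ | ⟨a, _ | ⟨b, s⟩⟩ <;> simp [nIn] at h₁
      rcases t with _ | ⟨c, _ | ⟨d, t⟩⟩ <;> simp [nIn, nOut] at h₂
      simp [nIn, nOut, Nat.add_comm 2] at h₃
      have : t = s := list_eq_of_getD h₂ fun j => by simp [h₃]
      simp [LocalColors] at h₄
      obtain ⟨rfl, h₅⟩ := h₄
      simp [BaseColors, this, h₅]

theorem listShift_baseColors_iff_getD (x : Slice) (i : ℕ) (s t : List A) :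
    ListShift (BaseColors x) i s t ↔ i + x.nIn ≤ s.length ∧
      t.length + x.nIn = s.length + x.nOut ∧ (∀ j < i, s.getD j 0 = t.getD j 0) ∧
      (∀ j, s.getD (i + x.nIn + j) 0 = t.getD (i + x.nOut + j) 0) ∧
      x.LocalColors (s.getD i 0) (s.getD (i + 1) 0) (t.getD i 0) (t.getD (i + 1) 0) := by
  induction i generalizing s t with
  | zero => simpa [ListShift] using baseColors_iff_getD x s t
  | succ i ih =>
    rcases s with _ | ⟨a, s⟩
    · simp only [ListShift, List.length_nil]
      exact ⟨by simp, fun h => by omega⟩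
    · rcases t with _ | ⟨b, t⟩
      · simp only [ListShift, List.length_cons, List.length_nil]
        exact ⟨by simp, fun h => by omega⟩
      · have e : ∀ n j, i + 1 + n + j = i + n + j + 1 := fun n j => by omega
        have : ListShift (BaseColors x) (i + 1) (a :: s) (b :: t) ↔
            a = b ∧ ListShift (BaseColors x) i s t := by
          simp only [ListShift, List.cons.injEq]
          grind
        rw [this, ih]
        simp only [e, List.getD_cons_succ, List.length_cons, Nat.forall_lt_succ_left',
          List.getD_cons_zero]
        constructor
        · rintro ⟨h₀, h₁, h₂, h₃, h₄, h₅⟩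
          exact ⟨by omega, by omega, ⟨h₀, h₃⟩, h₄, h₅⟩
        · rintro ⟨h₁, h₂, ⟨h₀, h₃⟩, h₄, h₅⟩
          exact ⟨h₀, by omega, by omega, h₃, h₄, h₅⟩

theorem Colors.getD_eq_of_joins {x : Slice} {s t : List A} (h : Colors x s t) {a b : ℕ × ℕ}
    (hab : Joins x a b) : (if a.1 = 0 then s else t).getD a.2 0 =
      (if b.1 = 0 then s else t).getD b.2 0 := by
  obtain ⟨-, -, h₁, h₂, h₃⟩ := (listShift_baseColors_iff_getD x x.pos s t).mp h
  cases hab with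
  | left => exact h₁ _ ‹_›
  | right => exact h₂ _
  | min i => simpa [LocalColors, pos] using h₃
  | max i => simpa [LocalColors, pos] using h₃
  | over_right i => simpa [LocalColors, pos] using h₃.1
  | over_left i => simpa [LocalColors, pos] using h₃.1

theorem Joins.fst_le_one {x : Slice} {a b : ℕ × ℕ} (h : Joins x a b) : a.1 ≤ 1 ∧ b.1 ≤ 1 := by
  cases h <;> simp

theorem stackColors_of_sequence (w : List Slice) (S : ℕ → List A)
    (h : ∀ k (hk : k < w.length), Colors w[k] (S k) (S (k + 1))) :
    StackColors w (S 0) (S w.length) {c | ∃ k ≤ w.length, c ∈ S k} := by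
  induction w generalizing S with
  | nil => exact ⟨rfl, by simp⟩
  | cons x w ih =>
    refine ⟨S 1, _, h 0 (by simp), ih (fun k => S (k + 1)) fun k hk => ?_, ?_⟩
    · exact h (k + 1) (by simpa using hk)
    · ext c
      constructor
      · rintro ⟨_ | k, hk, hc⟩
        · exact Or.inl hc
        · exact Or.inr ⟨k, by simpa using hk, hc⟩
      · rintro (hc | ⟨k, hk, hc⟩)
        · exact ⟨0, by simp, hc⟩
        · exact ⟨k + 1, by simpa using hk, hc⟩

theorem StackColors.exists_sequence {w : List Slice} {s t : List A} {N : Set A}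
    (h : StackColors w s t N) : ∃ S : ℕ → List A, S 0 = s ∧
      (∀ k (hk : k < w.length), Colors w[k] (S k) (S (k + 1))) ∧
      ∀ c ∈ N, ∃ k ≤ w.length, c ∈ S k := by
  induction w generalizing s N with
  | nil =>
    obtain ⟨rfl, rfl⟩ := h
    exact ⟨fun _ => s, rfl, by simp, fun c hc => ⟨0, le_rfl, hc⟩⟩
  | cons x w ih =>
    obtain ⟨u, N', hx, hw, rfl⟩ := h
    obtain ⟨S, rfl, hS, hN⟩ := ih hw
    refine ⟨fun k => Nat.casesOn k s S, rfl, ?_, ?_⟩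
    · rintro (_ | k) hk
      · exact hx
      · exact hS k (by simpa using hk)
    · rintro c (hc | hc)
      · exact ⟨0, by simp, hc⟩
      · obtain ⟨k, hk, hc'⟩ := hN c hc
        exact ⟨k + 1, by simpa using hk, hc'⟩

theorem Stack.count_eq_zero {n : ℕ} {w : List Slice} (h : Stack n w) : count n w = 0 := by
  induction w generalizing n with
  | nil => exact h
  | cons x w ih => exact ih h.2

end Slice

section

open Slice

namespace LinkDiagram

variable {A : Type*} [CommRing A] (D : LinkDiagram)

/-- Colorings of the arcs of a diagram with elements of a commutative ring. -/
def IsRingColoring (f : D.Arc → A) : Prop :=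
  ∀ c : D.Crossing, 2 * f (D.overArc c) = f (D.underLower c) + f (D.underUpper c)

theorem isRingColoring_iff (f : D.Arc → A) : D.IsRingColoring f ↔ ∀ c : D.Crossing,
    (D.RisingOver c → 2 * f (D.lowerLeft c) = f (D.lowerRight c) + f (D.upperLeft c)) ∧
    (¬ D.RisingOver c → 2 * f (D.lowerRight c) = f (D.lowerLeft c) + f (D.upperRight c)) := by
  refine forall_congr' fun c => ?_
  by_cases h : D.RisingOver c <;> simp [overArc, underLower, underUpper, h]

open Classical in
/-- The color on the horizontal line `k` at position `j`, or `0` if there is no such point. -/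
noncomputable def colorAt (f : D.Arc → A) (k j : ℕ) : A :=
  if h : k ≤ D.slices.length ∧ j < D.width k then f (D.arcAt k j h.1 h.2) else 0

/-- The colors on the horizontal line `k`. -/
noncomputable def lineColors (f : D.Arc → A) (k : ℕ) : List A :=
  (List.range (D.width k)).map (D.colorAt f k)

theorem colorAt_eq (f : D.Arc → A) {k j : ℕ} (hk : k ≤ D.slices.length) (hj : j < D.width k) :
    D.colorAt f k j = f (D.arcAt k j hk hj) := dif_pos ⟨hk, hj⟩

theorem length_lineColors (f : D.Arc → A) (k : ℕ) : (D.lineColors f k).length = D.width k := by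
  simp [lineColors]

theorem getD_lineColors (f : D.Arc → A) (k j : ℕ) :
    (D.lineColors f k).getD j 0 = D.colorAt f k j := by
  by_cases h : j < D.width k
  · simp [lineColors, h]
  · rw [List.getD_eq_default _ _ (by rw [length_lineColors]; omega), colorAt, dif_neg]
    exact fun h' => h h'.2

theorem width_succ {k : ℕ} (hk : k < D.slices.length) :
    D.width (k + 1) = D.slices[k].step (D.width k) :=
  count_take_succ 0 D.slices k hk

theorem fits_width {k : ℕ} (hk : k < D.slices.length) : D.slices[k].Fits (D.width k) :=
  D.stack.fits k hk

theorem width_zero : D.width 0 = 0 := rfl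

theorem width_length : D.width D.slices.length = 0 := by
  rw [width, List.take_length, D.stack.count_eq_zero]

theorem colorAt_eq_of_joins (f : D.Arc → A) {k : ℕ} (hk : k < D.slices.length) {a b : ℕ × ℕ}
    (hab : Joins D.slices[k] a b) (ha : k + a.1 ≤ D.slices.length) (hb : k + b.1 ≤ D.slices.length)
    (ha' : a.2 < D.width (k + a.1)) (hb' : b.2 < D.width (k + b.1)) :
    D.colorAt f (k + a.1) a.2 = D.colorAt f (k + b.1) b.2 := by
  rw [colorAt_eq D f ha ha', colorAt_eq D f hb hb']
  exact congrArg f (Quot.sound ⟨k, hk, a, b, hab, rfl, rfl, rfl, rfl⟩)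

theorem IsRingColoring.colors_lineColors {D : LinkDiagram} {f : D.Arc → A}
    (hf : D.IsRingColoring f) {k : ℕ} (hk : k < D.slices.length) :
    Colors D.slices[k] (D.lineColors f k) (D.lineColors f (k + 1)) := by
  have hfit : D.slices[k].pos + D.slices[k].nIn ≤ D.width k := D.fits_width hk
  have hw : D.width (k + 1) = D.width k - D.slices[k].nIn + D.slices[k].nOut := D.width_succ hk
  refine (listShift_baseColors_iff_getD _ _ _ _).mpr ?_
  simp only [length_lineColors, getD_lineColors]
  refine ⟨hfit, by omega, fun j hj => ?_, fun j => ?_, ?_⟩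
  · exact D.colorAt_eq_of_joins f hk (.left _ j hj) hk.le hk (by simp; omega) (by simp; omega)
  · by_cases h : D.slices[k].pos + D.slices[k].nIn + j < D.width k
    · exact D.colorAt_eq_of_joins f hk (.right _ j) hk.le hk (by simpa using h) (by simp; omega)
    · rw [colorAt, dif_neg (fun h' => h h'.2), colorAt, dif_neg]
      exact fun h' => by omega
  · generalize hx : D.slices[k] = x at hfit hw ⊢
    rcases x with i | i | ⟨i, s⟩
    · simp only [pos, nIn, nOut] at hfit hw
      exact D.colorAt_eq_of_joins f hk (a := (1, i)) (b := (1, i + 1)) (hx ▸ .min i) hk hk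
        (by simp only; omega) (by simp only; omega)
    · simp only [pos, nIn, nOut] at hfit hw
      exact D.colorAt_eq_of_joins f hk (a := (0, i)) (b := (0, i + 1)) (hx ▸ .max i) hk.le hk.le
        (by simp only [add_zero]; omega) (by simp only [add_zero]; omega)
    · simp only [pos, nIn, nOut] at hfit hw
      have hc := (D.isRingColoring_iff f).mp hf ⟨⟨k, hk⟩, by simp [hx, IsCross]⟩
      simp only [RisingOver, lowerLeft, lowerRight, upperLeft, upperRight, ← D.colorAt_eq f,
        Fin.getElem_fin, hx] at hc
      simp only [pos] at hc ⊢
      cases s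
      · refine ⟨?_, by simpa using hc⟩
        exact D.colorAt_eq_of_joins f (a := (0, i + 1)) (b := (1, i)) hk (hx ▸ .over_left i)
          hk.le hk (by simp only [add_zero]; omega) (by simp only; omega)
      · refine ⟨?_, by simpa using hc⟩
        exact D.colorAt_eq_of_joins f (a := (0, i)) (b := (1, i + 1)) hk (hx ▸ .over_right i)
          hk.le hk (by simp only [add_zero]; omega) (by simp only; omega)

theorem IsRingColoring.hasNonconstantStackColors {D : LinkDiagram} {f : D.Arc → A}
    (hf : D.IsRingColoring f) (hne : ∃ a b, f a ≠ f b) : D.HasNonconstantStackColors A := by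
  have h := stackColors_of_sequence D.slices (D.lineColors f) fun k hk => hf.colors_lineColors hk
  have h0 : D.lineColors f 0 = [] := by simp [lineColors, width_zero]
  have h1 : D.lineColors f D.slices.length = [] := by simp [lineColors, width_length]
  rw [h0, h1] at h
  refine ⟨_, h, fun c => ?_⟩
  have hmem : ∀ a, ∃ k ≤ D.slices.length, f a ∈ D.lineColors f k := by
    rintro ⟨⟨k, j⟩⟩
    exact ⟨k, Nat.le_of_lt_succ k.2, List.mem_map.mpr ⟨j, by simp,
      D.colorAt_eq f (Nat.le_of_lt_succ k.2) j.2⟩⟩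
  obtain ⟨a, b, hab⟩ := hne
  by_cases ha : f a = c
  · exact ⟨f b, hmem b, fun h => hab (ha.trans h.symm)⟩
  · exact ⟨f a, hmem a, ha⟩

theorem HasNonconstantStackColors.exists_isRingColoring {D : LinkDiagram}
    (h : D.HasNonconstantStackColors A) :
    ∃ f : D.Arc → A, D.IsRingColoring f ∧ ∃ a b, f a ≠ f b := by
  obtain ⟨N, hN, hne⟩ := h
  obtain ⟨S, hS₀, hS, hNS⟩ := hN.exists_sequence
  have hlen : ∀ k ≤ D.slices.length, (S k).length = D.width k := by
    intro k
    induction k with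
    | zero => simp [hS₀, width_zero]
    | succ k ih =>
      intro hk
      rw [(hS k hk).length, ih (by omega), D.width_succ hk]
  -- Points joined within a slice carry equal colors, so the line colors descend to arcs.
  let f : D.Arc → A := Quot.lift (fun P : D.Point => (S P.1).getD P.2 0) (by
    rintro ⟨k₁, j₁⟩ ⟨k₂, j₂⟩ ⟨k, hk, a, b, hab, h₁, h₂, h₃, h₄⟩
    have := (hS k hk).getD_eq_of_joins hab
    have hS' : ∀ n ≤ 1, S (k + n) = if n = 0 then S k else S (k + 1) := by
      intro n hn
      interval_cases n <;> simp
    have hab' := hab.fst_le_one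
    change (S k₁).getD j₁ 0 = (S k₂).getD j₂ 0
    simp only at h₁ h₂ h₃ h₄
    rw [h₂, h₄, h₁, h₃, hS' _ hab'.1, hS' _ hab'.2, this])
  refine ⟨f, (D.isRingColoring_iff f).mpr fun c => ?_, ?_⟩
  · obtain ⟨⟨k, hk⟩, hc⟩ := c
    have hcol := hS k hk
    obtain ⟨-, -, -, -, hloc⟩ := (listShift_baseColors_iff_getD _ _ _ _).mp hcol
    have hf : ∀ k j hk hj, f (D.arcAt k j hk hj) = (S k).getD j 0 := fun _ _ _ _ => rfl
    simp only [RisingOver, lowerLeft, lowerRight, upperLeft, upperRight, hf]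
    simp only [Fin.getElem_fin] at hc ⊢
    clear hcol
    obtain ⟨x, hx⟩ : ∃ x, D.slices[k] = x := ⟨_, rfl⟩
    simp only [hx] at hc hloc ⊢
    clear hx
    rcases x with i | i | ⟨i, _ | _⟩
    · exact hc.elim
    · exact hc.elim
    · simpa [pos] using hloc.2
    · simpa [pos] using hloc.2
  · have hval : ∀ c ∈ N, ∃ a, f a = c := by
      intro c hc
      obtain ⟨k, hk, hck⟩ := hNS c hc
      obtain ⟨j, hj, rfl⟩ := List.getElem_of_mem hck
      exact ⟨D.arcAt k j hk (hlen k hk ▸ hj), List.getD_eq_getElem _ _ hj⟩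
    obtain ⟨x, hx, -⟩ := hne 0
    obtain ⟨y, hy, hyx⟩ := hne x
    obtain ⟨a, rfl⟩ := hval x hx
    obtain ⟨b, rfl⟩ := hval y hy
    exact ⟨b, a, hyx⟩

end LinkDiagram

end

/-! ### Rational colorings, the determinant, and the number of colors. -/

namespace LinkDiagram

variable (D : LinkDiagram)

theorem coloringMatrix_mulVec (f : D.Arc → ℚ) (c : D.Crossing) :
    ((D.coloringMatrix.map (Int.cast : ℤ → ℚ)).mulVec f) c =
      2 * f (D.overArc c) - f (D.underLower c) - f (D.underUpper c) := by
  classical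
  simp only [Matrix.mulVec, dotProduct, coloringMatrix, Matrix.map_apply]
  push_cast
  simp only [sub_mul, ite_mul, zero_mul, one_mul, Finset.sum_sub_distrib, Finset.sum_ite_eq',
    Finset.mem_univ, if_true]

/-- A non-zero minor uses every column but that of one arc `a₀`. Subtracting the constant `f a₀`
gives a coloring supported on the chosen columns, which the invertible minor kills. -/
theorem IsRingColoring.eq_of_det_ne_zero {D : LinkDiagram} (hD : D.det ≠ 0) {f : D.Arc → ℚ}
    (hf : D.IsRingColoring f) (a b : D.Arc) : f a = f b := by
  classical
  obtain ⟨r, hr⟩ : ∃ r : (Fin (Fintype.card D.Arc - 1) → D.Crossing) ×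
      (Fin (Fintype.card D.Arc - 1) → D.Arc), (D.coloringMatrix.submatrix r.1 r.2).det ≠ 0 := by
    by_contra! h
    exact hD (Finset.gcd_eq_zero_iff.mpr fun r _ => by simp [h r])
  have hinj : Function.Injective r.2 := by
    intro i j hij
    by_contra hne
    exact hr (Matrix.det_zero_of_column_eq hne fun k => by simp [hij])
  obtain ⟨a₀, ha₀⟩ : ∃ a₀, a₀ ∉ Set.range r.2 := by
    by_contra! h
    have h1 := Fintype.card_le_of_surjective r.2 h
    have h2 : 0 < Fintype.card D.Arc := Fintype.card_pos_iff.mpr ⟨a⟩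
    rw [Fintype.card_fin] at h1
    omega
  have hrange : ∀ x, x ≠ a₀ → x ∈ Set.range r.2 := by
    intro x hx
    by_contra hxr
    have h1 : (Finset.univ.image r.2).card = Fintype.card D.Arc - 1 := by
      rw [Finset.card_image_of_injective _ hinj, Finset.card_univ, Fintype.card_fin]
    have h2 : (insert x (insert a₀ (Finset.univ.image r.2))).card ≤ Fintype.card D.Arc :=
      Finset.card_le_univ _
    rw [Finset.card_insert_of_notMem (by simpa [hx] using hxr),
      Finset.card_insert_of_notMem (by simpa using ha₀), h1] at h2
    omega
  set g : D.Arc → ℚ := fun x => f x - f a₀ with hg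
  have hker : ((D.coloringMatrix.submatrix r.1 r.2).map (Int.cast : ℤ → ℚ)).mulVec (g ∘ r.2)
      = 0 := by
    ext i
    have h1 := D.coloringMatrix_mulVec g (r.1 i)
    have h2 : 2 * g (D.overArc (r.1 i)) - g (D.underLower (r.1 i)) - g (D.underUpper (r.1 i))
        = 0 := by
      have := hf (r.1 i)
      simp only [hg]
      linarith
    rw [h2] at h1
    rw [Pi.zero_apply, ← h1]
    simp only [Matrix.mulVec, dotProduct, Matrix.map_apply, Matrix.submatrix_apply,
      Function.comp_apply]
    rw [← Finset.sum_image (s := Finset.univ) (g := r.2)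
      (f := fun x => (D.coloringMatrix (r.1 i) x : ℚ) * g x) (fun i _ j _ h => hinj h)]
    refine Finset.sum_subset (Finset.subset_univ _) fun x _ hx => ?_
    have : x = a₀ := by
      by_contra hne
      exact hx (by simpa using hrange x hne)
    simp [this, hg]
  have hzero : g ∘ r.2 = 0 := by
    by_contra hne
    have h1 := Matrix.exists_mulVec_eq_zero_iff.mp ⟨g ∘ r.2, hne, hker⟩
    have h2 : ((Int.castRingHom ℚ).mapMatrix (D.coloringMatrix.submatrix r.1 r.2)).det = 0 := h1
    rw [← RingHom.map_det] at h2
    exact hr (by simpa using h2)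
  have hconst : ∀ x, f x = f a₀ := by
    intro x
    by_cases hx : x = a₀
    · rw [hx]
    · obtain ⟨i, rfl⟩ := hrange x hx
      exact sub_eq_zero.mp (congrFun hzero i)
  rw [hconst a, hconst b]

/-- If a diagram has only constant rational colorings, then a coloring modulo a prime `p` with `n`
colors that is not constant satisfies `p ≤ 2 ^ (n - 1)`. -/
theorem IsNontrivialColoring.le_two_pow {D : LinkDiagram} {p : ℕ} (hp : p.Prime)
    {f : D.Arc → ZMod p} (hf : D.IsNontrivialColoring p f)
    (hD : ∀ g : D.Arc → ℚ, D.IsRingColoring g → ∀ a b, g a = g b) :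
    p ≤ 2 ^ ((Set.range f).ncard - 1) := by
  classical
  have : Fact p.Prime := ⟨hp⟩
  obtain ⟨hcol, a₀, b₀, hab⟩ := hf
  -- The base color `f a₀` is dropped to remove the constant solutions; this is the `- 1` in the
  -- exponent.
  set C : Finset (ZMod p) := (Finset.univ.image f).erase (f a₀) with hC
  have hcard : C.card = (Set.range f).ncard - 1 := by
    rw [hC, Finset.card_erase_of_mem (by simp), ← Set.ncard_coe_finset]
    simp
  rw [← hcard]
  let c : Fin C.card → ZMod p := fun j => C.equivFin.symm j
  have hc : Function.Injective c := Subtype.val_injective.comp C.equivFin.symm.injective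
  have hcne : ∀ j, c j ≠ f a₀ := fun j => Finset.ne_of_mem_erase (C.equivFin.symm j).2
  have hcsurj : ∀ x, f x ≠ f a₀ → ∃ j, c j = f x := fun x hx =>
    ⟨C.equivFin ⟨f x, by simp [hC, hx]⟩, by simp [c]⟩
  let M : Matrix D.Crossing (Fin C.card) ℤ := Matrix.of fun i j =>
    (if c j = f (D.overArc i) then (2 : ℤ) else 0) - (if c j = f (D.underLower i) then 1 else 0)
      - if c j = f (D.underUpper i) then 1 else 0
  -- A vector on the colors, extended by zero to the base color, pulls back to arcs, and `M`
  -- evaluates the crossing equations on it. Used over `ℚ` and over `ZMod p`.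
  have hsum : ∀ {R : Type} [CommRing R] (x : Fin C.card → R) (y : D.Arc → R),
      (∀ a, y a = ∑ j, if c j = f a then x j else 0) → ∀ i,
      ((M.map (Int.cast : ℤ → R)).mulVec x) i =
        2 * y (D.overArc i) - y (D.underLower i) - y (D.underUpper i) := by
    intro R _ x y hy i
    simp only [Matrix.mulVec, dotProduct, M, Matrix.map_apply, Matrix.of_apply, hy]
    push_cast
    simp only [sub_mul, ite_mul, zero_mul, one_mul, Finset.sum_sub_distrib, Finset.mul_sum,
      mul_ite, mul_zero]
  have hker : ∀ x : Fin C.card → ℚ, (M.map (Int.cast : ℤ → ℚ)).mulVec x = 0 → x = 0 := by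
    intro x hx
    have hg : D.IsRingColoring fun a => ∑ j, if c j = f a then x j else 0 := by
      intro i
      have := hsum x _ (fun _ => rfl) i
      rw [hx, Pi.zero_apply] at this
      linear_combination -this
    ext j
    obtain ⟨a, -, ha⟩ := Finset.mem_image.mp (Finset.mem_of_mem_erase (C.equivFin.symm j).2)
    have h := hD _ hg a a₀
    have haj : ∀ j', c j' = f a ↔ j' = j := fun j' => by
      rw [ha]; exact hc.eq_iff
    simpa [haj, hcne] using h
  obtain ⟨r, hr⟩ := Matrix.exists_rows_det_ne_zero _ _ hker
  have hdet : (M.submatrix r id).det ≠ 0 := by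
    intro h
    refine hr ?_
    have : ((Int.castRingHom ℚ).mapMatrix (M.submatrix r id)).det = 0 := by
      rw [← RingHom.map_det, h, map_zero]
    exact this
  have hdvd : (p : ℤ) ∣ (M.submatrix r id).det := by
    rw [← ZMod.intCast_zmod_eq_zero_iff_dvd _ p]
    have h1 : ((Int.castRingHom (ZMod p)).mapMatrix (M.submatrix r id)).det = 0 := by
      -- This vector pulls back to the coloring `f - f a₀`; it is non-zero because of the arc `b₀`.
      refine Matrix.exists_mulVec_eq_zero_iff.mp ⟨fun j => c j - f a₀, fun h => ?_, ?_⟩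
      · obtain ⟨j, hj⟩ := hcsurj b₀ hab.symm
        exact hab (sub_eq_zero.mp (hj ▸ congrFun h j)).symm
      · ext i
        have hy : ∀ a, f a - f a₀ = ∑ j, if c j = f a then c j - f a₀ else 0 := by
          intro a
          by_cases ha : f a = f a₀
          · simp [ha, hcne]
          · obtain ⟨j, hj⟩ := hcsurj a ha
            simp [← hj, hc.eq_iff]
        refine (hsum (fun j => c j - f a₀) (fun a => f a - f a₀) hy (r i)).trans ?_
        rw [Pi.zero_apply]
        linear_combination hcol (r i)
    rw [← RingHom.map_det] at h1
    exact h1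
  have hbound := Matrix.abs_det_le_two_pow_of_row_second_differences C.card c hc
    (fun i => f (D.overArc (r i))) (fun i => f (D.underLower (r i)))
    (fun i => f (D.underUpper (r i)))
  have := (Int.le_of_dvd (abs_pos.mpr hdet) ((dvd_abs _ _).mpr hdvd)).trans hbound
  exact_mod_cast this

end LinkDiagram

/-! ### Passage from diagrams to links, and the bound. -/

/-- A diagram of a link with non-zero determinant has only constant rational colorings. -/
theorem Link.IsDiagram.eq_of_det_ne_zero {L : Link} {D : LinkDiagram} (hD : L.IsDiagram D)
    (hL : L.det ≠ 0) {f : D.Arc → ℚ} (hf : D.IsRingColoring f) (a b : D.Arc) : f a = f b := by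
  by_contra hne
  have hout : L.IsDiagram (Quot.out L) := Quot.out_eq L
  -- A non-constant coloring of `D` is carried to the representative from which `L.det` is computed.
  obtain ⟨g, hg, x, y, hxy⟩ := ((hD.hasNonconstantStackColors_iff hout).mp
    (hf.hasNonconstantStackColors ⟨a, b, hne⟩)).exists_isRingColoring
  exact hxy (hg.eq_of_det_ne_zero hL x y)

theorem mainTheorem1 (L : Link) (hL : L.det ≠ 0) (p : ℕ) (hp : p.Prime) (hp17 : 17 ≤ p)
    (hcol : L.Colorable p) : 6 ≤ L.mincol p := by
  obtain ⟨E, hE, hEp⟩ := hcol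
  -- Colorability makes both infima range over non-empty sets, so they are attained.
  obtain ⟨D, hD, hDp, hmin⟩ : L.mincol p ∈
      {n | ∃ D : LinkDiagram, L.IsDiagram D ∧ D.Colorable p ∧ D.minColors p = n} :=
    Nat.sInf_mem ⟨_, E, hE, hEp, rfl⟩
  obtain ⟨f₀, hf₀⟩ := hDp
  obtain ⟨f, hf, hcard⟩ : D.minColors p ∈
      {n | ∃ f : D.Arc → ZMod p, D.IsNontrivialColoring p f ∧ (Set.range f).ncard = n} :=
    Nat.sInf_mem ⟨_, f₀, hf₀, rfl⟩
  have h := hf.le_two_pow hp fun g hg => hD.eq_of_det_ne_zero hL hg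
  rw [← hmin, ← hcard]
  by_contra hlt
  have : 2 ^ ((Set.range f).ncard - 1) ≤ 2 ^ 4 := Nat.pow_le_pow_right two_pos (by omega)
  omega
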